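/- Conventions. A hyperplane arrangement $\mathcal{A}$ in $\mathbb{R}^V$ ($V$ a finite set) is a finite set of affine hyperplanes. Its intersection poset $L(\mathcal{A})$ consists of all nonempty intersections of members of $\mathcal{A}$ (including the whole space $\mathbb{R}^V$, the empty intersection), ordered by reverse inclusion; $\mu(X)$ is its Möbius function, given by $\mu(\mathbb{R}^V)=1$ and $\mu(X)=-\sum_{Y<X}\mu(Y)$ for $X>\mathbb{R}^V$. The characteristic polynomial is $\chi(\mathcal{A},t)=\sum_{X\in L(\mathcal{A})}\mu(X)\,t^{\dim X}$. The chambers of $\mathcal{A}$ are the connected components of $\mathbb{R}^V\setminus\bigcup_{H\in\mathcal{A}}H$, and $c(\mathcal{A})$ is their number. A set $S\subseteq\mathcal{A}$ is dependent if $\bigcap_{H\in S}H\neq\emptyset$ and the polynomials $\alpha_H$ of degree one ($H\in S$, $H=\alpha_H^{-1}(0)$) are linearly dependent. The graphic arrangement of a simple graph $G=(V,E)$ is $\mathcal{A}(G)=\{\{x_i-x_j=0\} : \{i,j\}\in E\}$ in $\mathbb{R}^V$. Theorem. Let $G=(V,E)$ be a finite simple graph with $n=|V|$ vertices, let $v_1\ne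 v_2$ be vertices with $e_0=\{v_1,v_2\}\notin E$, let $G'=(V,E\cup\{e_0\})$, and let $H_0=\{x_{v_1}-x_{v_2}=0\}$, so that $\mathcal{A}(G')=\mathcal{A}(G)\cup\{H_0\}$. Suppose that no (inclusion-)minimal dependent set $S$ of $\mathcal{A}(G')$ with $|S|\le n$ contains $H_0$ (in particular, this holds if no dependent set of $\mathcal{A}(G')$ with at most $n$ elements contains $H_0$). Then $$\chi(\mathcal{A}(G'),t)=\frac{\chi(\mathcal{A}(G),t)\,(t-1)}{t},$$ that is, $t\,\chi(\mathcal{A}(G'),t)=\chi(\mathcal{A}(G),t)(t-1)$ in $\mathbb{Z}[t]$. Moreover, $\mathcal{A}(G)$ and $\mathcal{A}(G')$ have finitely many chambers, and $c(\mathcal{A}(G'))=2\,c(\mathcal{A}(G))$. -/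

import Mathlib

/-- The affine function `α` on `K^V`, i.e. a polynomial of degree one in the coordinates, is a
defining polynomial of `H`: it is not constant and `H = α⁻¹(0)`. -/
def IsDefiningPolynomial {K V : Type*} [Field K] (α : (V → K) →ᵃ[K] K)
    (H : AffineSubspace K (V → K)) : Prop :=
  α.linear ≠ 0 ∧ ∀ x, x ∈ H ↔ α x = 0

/-- An affine hyperplane of `K^V`: the zero set of a polynomial of degree one. -/
def IsAffineHyperplane {K V : Type*} [Field K] (H : AffineSubspace K (V → K)) : Prop :=
  ∃ α : (V → K) →ᵃ[K] K, IsDefiningPolynomial α H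

/-- A hyperplane arrangement in `K^V`: a finite set of affine hyperplanes. -/
structure HyperplaneArrangement (K V : Type*) [Field K] where
  hyperplanes : Set (AffineSubspace K (V → K))
  finite : hyperplanes.Finite
  isHyperplane : ∀ H ∈ hyperplanes, IsAffineHyperplane H

namespace HyperplaneArrangement

variable {K V : Type*} [Field K]

/-- The set `L(A)` of all nonempty intersections of hyperplanes of `A`; the empty intersection
is the whole space `⊤`. -/
def flats (A : HyperplaneArrangement K V) : Set (AffineSubspace K (V → K)) :=
  {X | (X : Set (V → K)).Nonempty ∧ ∃ B ⊆ A.hyperplanes, X = sInf B}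

theorem finite_flats (A : HyperplaneArrangement K V) : A.flats.Finite := by
  refine (A.finite.finite_subsets.image sInf).subset ?_
  rintro X ⟨-, B, hB, rfl⟩
  exact ⟨B, hB, rfl⟩

/-- The intersection poset `L(A)`, ordered by reverse inclusion. -/
abbrev IntersectionLattice (A : HyperplaneArrangement K V) : Type _ :=
  (A.flats)ᵒᵈ

/-- The affine subspace underlying an element of `L(A)`. -/
def subspace (A : HyperplaneArrangement K V) (X : A.IntersectionLattice) :
    AffineSubspace K (V → K) :=
  (OrderDual.ofDual X).1

/-- The whole space, the least element of `L(A)`. -/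
def whole (A : HyperplaneArrangement K V) : A.IntersectionLattice :=
  OrderDual.toDual ⟨⊤, ⟨0, AffineSubspace.mem_top K (V → K) 0⟩, ∅, Set.empty_subset _,
    sInf_empty.symm⟩

noncomputable instance (A : HyperplaneArrangement K V) : Fintype A.IntersectionLattice :=
  letI : Fintype A.flats := A.finite_flats.fintype
  inferInstanceAs (Fintype (A.flats)ᵒᵈ)

open Classical in
noncomputable instance (A : HyperplaneArrangement K V) :
    LocallyFiniteOrder A.IntersectionLattice :=
  Fintype.toLocallyFiniteOrder

open Classical in
/-- The Möbius function `μ(X) = μ(K^V, X)` of `L(A)`. -/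
noncomputable def moebius (A : HyperplaneArrangement K V) (X : A.IntersectionLattice) : ℤ :=
  IncidenceAlgebra.mu ℤ A.whole X

/-- The characteristic polynomial `∑ X ∈ L(A), μ(X) t ^ dim X`. -/
noncomputable def charPoly (A : HyperplaneArrangement K V) : Polynomial ℤ :=
  ∑ X : A.IntersectionLattice,
    Polynomial.C (A.moebius X) * Polynomial.X ^ Module.finrank K (A.subspace X).direction

/-- A set `S` of hyperplanes of `A` is dependent if its intersection is nonempty and the
defining polynomials of its members are linearly dependent. (A defining polynomial is unique up
to a nonzero scalar, so the choice of the polynomials does not matter.) -/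
def IsDependent (A : HyperplaneArrangement K V) (S : Set (AffineSubspace K (V → K))) : Prop :=
  S ⊆ A.hyperplanes ∧ (∃ x, ∀ H ∈ S, x ∈ H) ∧
    ∃ α : AffineSubspace K (V → K) → ((V → K) →ᵃ[K] K),
      (∀ H ∈ S, IsDefiningPolynomial (α H) H) ∧ ¬ LinearIndepOn K α S

/-- A minimal dependent set (with respect to inclusion). -/
def IsMinimalDependent (A : HyperplaneArrangement K V)
    (S : Set (AffineSubspace K (V → K))) : Prop :=
  Minimal A.IsDependent S

/-- The complement of the union of the hyperplanes of `A`. -/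
def complement (A : HyperplaneArrangement K V) : Set (V → K) :=
  {x | ∀ H ∈ A.hyperplanes, x ∉ H}

/-- The chambers of a real arrangement: the connected components of its complement. -/
abbrev Chamber (A : HyperplaneArrangement ℝ V) : Type _ :=
  ConnectedComponents A.complement

/-- The number `c(A)` of chambers of a real arrangement. -/
noncomputable def numChambers (A : HyperplaneArrangement ℝ V) : ℕ :=
  Nat.card A.Chamber

end HyperplaneArrangement

/-- The linear form `x_i - x_j` on `K^V`. -/
def coordinateDifference (K : Type*) {V : Type*} [Field K] (i j : V) : (V → K) →ₗ[K] K :=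
  LinearMap.proj (R := K) (φ := fun _ : V => K) i - LinearMap.proj (R := K) (φ := fun _ : V => K) j

/-- The subspace `{x_i - x_j = 0}` of `K^V`. -/
def diagonalHyperplane (K : Type*) {V : Type*} [Field K] (i j : V) :
    AffineSubspace K (V → K) :=
  (LinearMap.ker (coordinateDifference K i j)).toAffineSubspace

theorem isAffineHyperplane_diagonalHyperplane (K : Type*) {V : Type*} [Field K] {i j : V}
    (h : i ≠ j) : IsAffineHyperplane (diagonalHyperplane K i j) := by
  classical
  refine ⟨(coordinateDifference K i j).toAffineMap, ?_, ?_⟩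
  · intro h0
    have := LinearMap.congr_fun h0 (Pi.single i 1)
    simp [coordinateDifference, h.symm] at this
  · intro x
    simp [diagonalHyperplane]

/-- The graphic arrangement `A(G) = {{x_i - x_j = 0} | {i, j} an edge of G}` in `K^V`. -/
def graphicArrangement (K : Type*) {V : Type*} [Field K] [Finite V] (G : SimpleGraph V) :
    HyperplaneArrangement K V where
  hyperplanes := {H | ∃ i j, G.Adj i j ∧ H = diagonalHyperplane K i j}
  finite := by
    refine (Set.finite_range fun p : V × V => diagonalHyperplane K p.1 p.2).subset ?_
    rintro H ⟨i, j, -, rfl⟩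
    exact ⟨(i, j), rfl⟩
  isHyperplane := by
    rintro H ⟨i, j, h, rfl⟩
    exact isAffineHyperplane_diagonalHyperplane K h.ne

/-! The hypothesis yields a vector `u` on all hyperplanes of `A(G)` but off `H₀`
(`exists_mem_forall_notMem`). Otherwise the form of `H₀` is a combination of the other forms, hence
of a basis `B` of them. All forms kill the constant vector, so `|B| ≤ n - 1`, and `B ∪ {H₀}`
contains a minimal dependent set of size at most `n`; it must involve `H₀`, as `B` is independent.
Scale `u` so that the form `f` of `H₀` is 1 on it. Since `A(G)` is invariant along `u`, cutting by
`H₀` doubles everything. The poset becomes `L(A(G))` times a two-element chain (`latticeIso`): each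
flat keeps its term `μ t^d` and gains `-μ t^(d-1)`. Each chamber is split in two by the sign of `f`
(`chamberEquiv`). -/

theorem IncidenceAlgebra.mu_orderIso {P Q : Type*} [PartialOrder P] [PartialOrder Q]
    [LocallyFiniteOrder P] [LocallyFiniteOrder Q] [DecidableEq P] [DecidableEq Q]
    (e : P ≃o Q) (a b : P) :
    IncidenceAlgebra.mu ℤ (e a) (e b) = IncidenceAlgebra.mu ℤ a b := by
  induction h : (Finset.Icc a b).card using Nat.strong_induction_on generalizing b with
  | _ n ih =>
    subst h
    rw [IncidenceAlgebra.mu_apply, IncidenceAlgebra.mu_apply]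
    simp only [EmbeddingLike.apply_eq_iff_eq]
    congr 2
    refine (Finset.sum_equiv e.toEquiv (fun x => by simp) fun x hx => ?_).symm
    rw [Finset.mem_Ico] at hx
    refine (ih _ (Finset.card_lt_card ?_) x rfl).symm
    exact Finset.Icc_ssubset_Icc_right (hx.1.trans hx.2.le) le_rfl hx.2

/-! ### Intersection poset and characteristic polynomial of a transversal extension -/

namespace HyperplaneArrangement

section Extension

variable {K V : Type*} [Field K]

/-- `A'` arises from `A` by adding the kernel of the linear form `f`, where all hyperplanes of `A`
are invariant under translation along a vector `u` with `f u = 1`. -/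
structure IsTransversalExtension (A A' : HyperplaneArrangement K V) (f : (V → K) →ₗ[K] K)
    (u : V → K) : Prop where
  hyperplanes_eq : A'.hyperplanes = insert (LinearMap.ker f).toAffineSubspace A.hyperplanes
  apply_eq_one : f u = 1
  add_smul_mem : ∀ H ∈ A.hyperplanes, ∀ x ∈ H, ∀ t : K, x + t • u ∈ H

namespace IsTransversalExtension

variable {A A' : HyperplaneArrangement K V} {f : (V → K) →ₗ[K] K} {u : V → K}

theorem add_smul_mem_iff (h : IsTransversalExtension A A' f u)
    {H : AffineSubspace K (V → K)} (hH : H ∈ A.hyperplanes) (x : V → K) (t : K) :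
    x + t • u ∈ H ↔ x ∈ H :=
  ⟨fun hx => by simpa using h.add_smul_mem H hH _ hx (-t), fun hx => h.add_smul_mem H hH x hx t⟩

theorem add_smul_mem_flat (h : IsTransversalExtension A A' f u)
    {X : AffineSubspace K (V → K)} (hX : X ∈ A.flats) {x : V → K} (hx : x ∈ X) (t : K) :
    x + t • u ∈ X := by
  obtain ⟨-, B, hB, rfl⟩ := hX
  rw [AffineSubspace.mem_sInf_iff] at hx ⊢
  exact fun H hH => h.add_smul_mem H (hB hH) x (hx H hH) t

theorem mem_flats (h : IsTransversalExtension A A' f u) {X : AffineSubspace K (V → K)}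
    (hX : X ∈ A.flats) : X ∈ A'.flats := by
  obtain ⟨hne, B, hB, rfl⟩ := hX
  exact ⟨hne, B, hB.trans (h.hyperplanes_eq ▸ Set.subset_insert _ _), rfl⟩

theorem sub_smul_mem_inf (h : IsTransversalExtension A A' f u) {X : AffineSubspace K (V → K)}
    (hX : X ∈ A.flats) {x : V → K} (hx : x ∈ X) :
    x + (-f x) • u ∈ X ⊓ (LinearMap.ker f).toAffineSubspace := by
  refine ⟨h.add_smul_mem_flat hX hx _, ?_⟩
  simp [h.apply_eq_one]

theorem inf_mem_flats (h : IsTransversalExtension A A' f u) {X : AffineSubspace K (V → K)}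
    (hX : X ∈ A.flats) : X ⊓ (LinearMap.ker f).toAffineSubspace ∈ A'.flats := by
  have hX' := hX
  obtain ⟨⟨x, hx⟩, B, hB, rfl⟩ := hX'
  refine ⟨⟨_, h.sub_smul_mem_inf hX hx⟩, insert (LinearMap.ker f).toAffineSubspace B, ?_, ?_⟩
  · rw [h.hyperplanes_eq]
    exact Set.insert_subset_insert hB
  · rw [sInf_insert, inf_comm]

/-- A point of `X` slides along `u` onto the kernel of `f`, lands in `Y`, and slides back inside
`Y`. -/
theorem inf_le_iff (h : IsTransversalExtension A A' f u) {X Y : AffineSubspace K (V → K)}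
    (hX : X ∈ A.flats) (hY : Y ∈ A.flats) :
    X ⊓ (LinearMap.ker f).toAffineSubspace ≤ Y ↔ X ≤ Y := by
  refine ⟨fun hle x hx => ?_, fun hle => inf_le_left.trans hle⟩
  simpa using h.add_smul_mem_flat hY (hle (h.sub_smul_mem_inf hX hx)) (f x)

/-- A flat contains a line in direction `u`, on which `f` is not constant. So no uncut flat lies
above a cut one in the poset. -/
theorem not_le_ker (h : IsTransversalExtension A A' f u) {X : AffineSubspace K (V → K)}
    (hX : X ∈ A.flats) : ¬ X ≤ (LinearMap.ker f).toAffineSubspace := by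
  intro hle
  obtain ⟨x, hx⟩ := hX.1
  have h0 : f x = 0 := by simpa using hle hx
  have h1 : f (x + (1 : K) • u) = 0 := by simpa using hle (h.add_smul_mem_flat hX hx 1)
  simp [h0, h.apply_eq_one] at h1

theorem exists_flat (h : IsTransversalExtension A A' f u) {Z : AffineSubspace K (V → K)}
    (hZ : Z ∈ A'.flats) :
    ∃ X ∈ A.flats, Z = X ∨ Z = X ⊓ (LinearMap.ker f).toAffineSubspace := by
  obtain ⟨hne, B, hB, rfl⟩ := hZ
  rw [h.hyperplanes_eq] at hB
  by_cases h0 : (LinearMap.ker f).toAffineSubspace ∈ B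
  · have hB' : B = insert (LinearMap.ker f).toAffineSubspace
        (B \ {(LinearMap.ker f).toAffineSubspace}) := by
      simp [Set.insert_eq_of_mem h0]
    rw [hB', sInf_insert, inf_comm] at hne ⊢
    refine ⟨_, ⟨hne.mono inf_le_left, _, ?_, rfl⟩, Or.inr rfl⟩
    rintro H ⟨hH, hH0⟩
    exact (hB hH).resolve_left hH0
  · refine ⟨_, ⟨hne, B, fun H hH => (hB hH).resolve_left ?_, rfl⟩, Or.inl rfl⟩
    rintro rfl
    exact h0 hH

/-- The element of `L(A')` obtained from a flat `X` of `A` and a choice whether to intersect it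
with the added hyperplane. -/
def liftFlat (h : IsTransversalExtension A A' f u) (p : A.IntersectionLattice × Bool) :
    A'.IntersectionLattice :=
  OrderDual.toDual (if p.2 then ⟨_, h.inf_mem_flats (OrderDual.ofDual p.1).2⟩
    else ⟨_, h.mem_flats (OrderDual.ofDual p.1).2⟩)

theorem subspace_liftFlat_false (h : IsTransversalExtension A A' f u)
    (X : A.IntersectionLattice) : A'.subspace (h.liftFlat (X, false)) = A.subspace X := rfl

theorem subspace_liftFlat_true (h : IsTransversalExtension A A' f u)
    (X : A.IntersectionLattice) : A'.subspace (h.liftFlat (X, true)) =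
      A.subspace X ⊓ (LinearMap.ker f).toAffineSubspace := rfl

theorem le_iff_subspace_le {A : HyperplaneArrangement K V} {X Y : A.IntersectionLattice} :
    X ≤ Y ↔ A.subspace Y ≤ A.subspace X := Iff.rfl

theorem liftFlat_le_liftFlat (h : IsTransversalExtension A A' f u)
    (p q : A.IntersectionLattice × Bool) : h.liftFlat p ≤ h.liftFlat q ↔ p ≤ q := by
  obtain ⟨X, b⟩ := p
  obtain ⟨Y, c⟩ := q
  have hX : A.subspace X ∈ A.flats := (OrderDual.ofDual X).2
  have hY : A.subspace Y ∈ A.flats := (OrderDual.ofDual Y).2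
  cases b <;> cases c <;>
    simp [le_iff_subspace_le, subspace_liftFlat_false, subspace_liftFlat_true,
      h.inf_le_iff hY hX, h.not_le_ker hY]

theorem liftFlat_surjective (h : IsTransversalExtension A A' f u) :
    Function.Surjective h.liftFlat := by
  intro Z
  obtain ⟨X, hX, hZ | hZ⟩ := h.exists_flat (OrderDual.ofDual Z).2
  · exact ⟨(OrderDual.toDual ⟨X, hX⟩, false), Subtype.ext hZ.symm⟩
  · exact ⟨(OrderDual.toDual ⟨X, hX⟩, true), Subtype.ext hZ.symm⟩

/-- The intersection poset of `A'` is the product of that of `A` with a two-element chain. -/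
noncomputable def latticeIso (h : IsTransversalExtension A A' f u) :
    A.IntersectionLattice × Bool ≃o A'.IntersectionLattice :=
  RelIso.ofSurjective
    (OrderEmbedding.ofMapLEIff h.liftFlat h.liftFlat_le_liftFlat) h.liftFlat_surjective

theorem latticeIso_apply (h : IsTransversalExtension A A' f u)
    (p : A.IntersectionLattice × Bool) : h.latticeIso p = h.liftFlat p := rfl

theorem moebius_liftFlat (h : IsTransversalExtension A A' f u) (X : A.IntersectionLattice)
    (b : Bool) : A'.moebius (h.liftFlat (X, b)) = if b then -A.moebius X else A.moebius X := by
  classical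
  let _ : LocallyFiniteOrder Bool := Fintype.toLocallyFiniteOrder
  have h0 : A'.whole = h.latticeIso (A.whole, false) := rfl
  have hmu : IncidenceAlgebra.mu ℤ false b = if b then -1 else 1 := by
    cases b
    · simp
    · rw [IncidenceAlgebra.mu_eq_neg_sum_Ico_of_ne (by decide : false ≠ true),
        (by decide : Finset.Ico false true = {false})]
      simp
  -- The Möbius function of a product poset is the product of the Möbius functions.
  rw [moebius, h0, ← latticeIso_apply, IncidenceAlgebra.mu_orderIso,
    ← IncidenceAlgebra.mu_prod_mu, IncidenceAlgebra.prod_mk, hmu, moebius]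
  cases b <;> simp

theorem finrank_direction_inf_add_one [Finite V] (h : IsTransversalExtension A A' f u)
    {X : AffineSubspace K (V → K)} (hX : X ∈ A.flats) :
    Module.finrank K (X ⊓ (LinearMap.ker f).toAffineSubspace).direction + 1 =
      Module.finrank K X.direction := by
  obtain ⟨x, hx⟩ := hX.1
  have hp := h.sub_smul_mem_inf hX hx
  have hu : u ∈ X.direction := by
    have := AffineSubspace.vsub_mem_direction (h.add_smul_mem_flat hX hx 1) hx
    simpa using this
  rw [AffineSubspace.direction_inf_of_mem hp.1 hp.2, Submodule.toAffineSubspace_direction]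
  -- As `u` is a direction of `X`, `f` is onto there, and rank-nullity gives a drop of exactly one.
  have hrange : LinearMap.range (f.domRestrict X.direction) = ⊤ := by
    refine LinearMap.range_eq_top.2 fun c => ⟨c • ⟨u, hu⟩, ?_⟩
    simp [h.apply_eq_one]
  have hker : LinearMap.ker (f.domRestrict X.direction) =
      (X.direction ⊓ LinearMap.ker f).comap X.direction.subtype := by
    ext y
    simp
  have hrn := LinearMap.finrank_range_add_finrank_ker (f.domRestrict X.direction)
  rw [hrange, finrank_top, Module.finrank_self, hker,
    (Submodule.comapSubtypeEquivOfLe inf_le_left).finrank_eq] at hrn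
  omega

theorem X_mul_charPoly [Finite V] (h : IsTransversalExtension A A' f u) :
    Polynomial.X * A'.charPoly = A.charPoly * (Polynomial.X - 1) := by
  rw [charPoly, charPoly, ← h.latticeIso.toEquiv.sum_comp, Fintype.sum_prod_type, Finset.mul_sum,
    Finset.sum_mul]
  refine Finset.sum_congr rfl fun X _ => ?_
  have key : ∀ a b : ℕ, a + 1 = b →
      (Polynomial.X * (Polynomial.C (-A.moebius X) * Polynomial.X ^ a +
        Polynomial.C (A.moebius X) * Polynomial.X ^ b) : Polynomial ℤ) =
      Polynomial.C (A.moebius X) * Polynomial.X ^ b * (Polynomial.X - 1) := by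
    rintro a b rfl
    rw [map_neg]
    ring
  simp only [RelIso.coe_fn_toEquiv, latticeIso_apply, moebius_liftFlat, Fintype.sum_bool]
  exact key _ _ (h.finrank_direction_inf_add_one (OrderDual.ofDual X).2)

end IsTransversalExtension

end Extension

end HyperplaneArrangement

/-! ### Defining polynomials and diagonal hyperplanes -/

/-- Relative to a base point of `H`, both linear parts vanish exactly on the directions of `H`;
forms with equal kernels are proportional. -/
theorem IsDefiningPolynomial.exists_linear_eq_smul {K V : Type*} [Field K]
    {α β : (V → K) →ᵃ[K] K} {H : AffineSubspace K (V → K)} (hα : IsDefiningPolynomial α H)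
    (hβ : IsDefiningPolynomial β H) (hne : ∃ x, x ∈ H) :
    ∃ c : Kˣ, β.linear = c • α.linear := by
  obtain ⟨x, hx⟩ := hne
  have key : ∀ {γ : (V → K) →ᵃ[K] K}, IsDefiningPolynomial γ H →
      ∀ v, γ.linear v = 0 ↔ v + x ∈ H := by
    intro γ hγ v
    have h1 := γ.map_vadd x v
    rw [(hγ.2 x).1 hx, vadd_eq_add, vadd_eq_add, add_zero] at h1
    rw [hγ.2, h1]
  have hmem : β.linear ∈ Submodule.span K (Set.range fun _ : Unit => α.linear) := by
    refine mem_span_of_iInf_ker_le_ker fun v hv => ?_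
    have hv' : α.linear v = 0 := by simpa using hv
    exact (key hβ v).2 ((key hα v).1 hv')
  rw [Set.range_const, Submodule.mem_span_singleton] at hmem
  obtain ⟨c, hc⟩ := hmem
  have hc0 : c ≠ 0 := by
    rintro rfl
    exact hβ.1 (by rw [← hc, zero_smul])
  exact ⟨Units.mk0 c hc0, hc.symm⟩

theorem mem_diagonalHyperplane {K V : Type*} [Field K] {i j : V} {x : V → K} :
    x ∈ diagonalHyperplane K i j ↔ x i = x j := by
  simp [diagonalHyperplane, coordinateDifference, sub_eq_zero]

theorem diagonalHyperplane_comm (K : Type*) {V : Type*} [Field K] (i j : V) :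
    diagonalHyperplane K i j = diagonalHyperplane K j i := by
  ext x
  rw [mem_diagonalHyperplane, mem_diagonalHyperplane, eq_comm]

theorem hyperplanes_graphicArrangement_sup_edge (K : Type*) {V : Type*} [Field K] [Finite V]
    (G : SimpleGraph V) {v w : V} (hne : v ≠ w) :
    (graphicArrangement K (G ⊔ SimpleGraph.edge v w)).hyperplanes =
      insert (diagonalHyperplane K v w) (graphicArrangement K G).hyperplanes := by
  ext H
  simp only [graphicArrangement, Set.mem_ofPred_eq, Set.mem_insert_iff, SimpleGraph.sup_adj,
    SimpleGraph.edge_adj]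
  constructor
  · rintro ⟨i, j, hG | ⟨⟨rfl, rfl⟩ | ⟨rfl, rfl⟩, -⟩, rfl⟩
    · exact Or.inr ⟨i, j, hG, rfl⟩
    · exact Or.inl rfl
    · exact Or.inl (diagonalHyperplane_comm K _ _)
  · rintro (rfl | ⟨i, j, hG, rfl⟩)
    · exact ⟨v, w, Or.inr ⟨Or.inl ⟨rfl, rfl⟩, hne⟩, rfl⟩
    · exact ⟨i, j, Or.inl hG, rfl⟩

/-- The inclusion of linear forms into affine functions. -/
def LinearMap.toAffineMapLinear (K V : Type*) [Field K] :
    ((V → K) →ₗ[K] K) →ₗ[K] ((V → K) →ᵃ[K] K) where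
  toFun φ := φ.toAffineMap
  map_add' _ _ := rfl
  map_smul' _ _ := rfl

/-- The linear part of an affine function, as a linear map. -/
def AffineMap.linearPart (K V : Type*) [Field K] :
    ((V → K) →ᵃ[K] K) →ₗ[K] ((V → K) →ₗ[K] K) where
  toFun α := α.linear
  map_add' _ _ := rfl
  map_smul' _ _ := rfl

theorem exists_linear_defining_form {K V : Type*} [Field K] {H : AffineSubspace K (V → K)}
    (hH : IsAffineHyperplane H) (h0 : (0 : V → K) ∈ H) :
    ∃ φ : (V → K) →ₗ[K] K, IsDefiningPolynomial φ.toAffineMap H := by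
  obtain ⟨α, hα⟩ := hH
  refine ⟨α.linear, hα.1, fun x => ?_⟩
  have h1 := α.map_vadd 0 x
  rw [(hα.2 0).1 h0, vadd_eq_add, vadd_eq_add, add_zero, add_zero] at h1
  rw [hα.2, h1]
  rfl

/-! ### Dependent sets and the transversal vector -/

namespace HyperplaneArrangement

variable {K V : Type*} [Field K]

/-- Any other defining polynomials have linear parts that are unit multiples of `φ`, hence
independent, and independence lifts from linear parts to affine functions. -/
theorem not_isDependent_of_linearIndepOn (A : HyperplaneArrangement K V)
    {φ : AffineSubspace K (V → K) → ((V → K) →ₗ[K] K)} {S : Set (AffineSubspace K (V → K))}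
    (hφ : ∀ H ∈ S, IsDefiningPolynomial (φ H).toAffineMap H) (hS : LinearIndepOn K φ S) :
    ¬ A.IsDependent S := by
  rintro ⟨-, ⟨x, hx⟩, α, hα, hdep⟩
  refine hdep ?_
  have h1 : ∀ H : S, ∃ c : Kˣ, (α H).linear = c • φ H := fun H =>
    (hφ H H.2).exists_linear_eq_smul (hα H H.2) ⟨x, hx H H.2⟩
  choose c hc using h1
  have h2 := LinearIndependent.units_smul hS c
  refine LinearIndependent.of_comp (AffineMap.linearPart K V) ?_
  convert h2 using 1
  exact funext hc

theorem isDependent_of_not_linearIndepOn (A : HyperplaneArrangement K V)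
    {φ : AffineSubspace K (V → K) → ((V → K) →ₗ[K] K)} {S : Set (AffineSubspace K (V → K))}
    (hSA : S ⊆ A.hyperplanes) (hφ : ∀ H ∈ S, IsDefiningPolynomial (φ H).toAffineMap H)
    (hS : ¬ LinearIndepOn K φ S) : A.IsDependent S := by
  refine ⟨hSA, ⟨0, fun H hH => ?_⟩, fun H => (φ H).toAffineMap, hφ, fun hind => hS ?_⟩
  · rw [(hφ H hH).2]
    simp
  · exact LinearIndependent.of_comp (LinearMap.toAffineMapLinear K V) hind

/-- Let `H₀` be a hyperplane of a central arrangement that contains a common nonzero vector `w` of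
the hyperplanes. If no minimal dependent set with at most `|V|` elements contains `H₀`, then some
vector lies on all other hyperplanes but not on `H₀`. -/
theorem exists_mem_forall_notMem [Fintype V] (A : HyperplaneArrangement K V)
    {H₀ : AffineSubspace K (V → K)} (hH₀ : H₀ ∈ A.hyperplanes)
    (hcentral : ∀ H ∈ A.hyperplanes, (0 : V → K) ∈ H) {w : V → K} (hw : w ≠ 0)
    (hwA : ∀ H ∈ A.hyperplanes, w ∈ H)
    (hdep : ∀ S, A.IsMinimalDependent S → S.ncard ≤ Fintype.card V → H₀ ∉ S) :
    ∃ u, (∀ H ∈ A.hyperplanes, H ≠ H₀ → u ∈ H) ∧ u ∉ H₀ := by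
  classical
  by_contra! hu
  choose φ hφ using fun H : A.hyperplanes =>
    exists_linear_defining_form (A.isHyperplane H H.2) (hcentral H H.2)
  let ψ : AffineSubspace K (V → K) → ((V → K) →ₗ[K] K) := fun H =>
    if h : H ∈ A.hyperplanes then φ ⟨H, h⟩ else 0
  have hψ : ∀ H ∈ A.hyperplanes, IsDefiningPolynomial (ψ H).toAffineMap H := by
    intro H hH
    simpa [ψ, hH] using hφ ⟨H, hH⟩
  have hψmem : ∀ H ∈ A.hyperplanes, ∀ x, x ∈ H ↔ ψ H x = 0 := fun H hH => (hψ H hH).2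
  obtain ⟨B, hBA, -, hspan, hB⟩ := exists_linearIndepOn_extension
    (linearIndepOn_empty K ψ) (Set.empty_subset (A.hyperplanes \ {H₀}))
  have hBA' : B ⊆ A.hyperplanes := hBA.trans Set.sdiff_subset
  have hH₀B : H₀ ∉ B := fun h => (hBA h).2 rfl
  have hBfin : B.Finite := A.finite.subset hBA'
  -- By `hu`, the common kernel of the other forms lies in that of `ψ H₀`.
  have hmem : ψ H₀ ∈ Submodule.span K (ψ '' B) := by
    have : Finite A.hyperplanes := A.finite
    have : Finite ↑(A.hyperplanes \ {H₀}) := (A.finite.subset Set.sdiff_subset).to_subtype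
    refine Submodule.span_le.2 hspan ?_
    rw [Set.image_eq_range]
    refine mem_span_of_iInf_ker_le_ker fun v hv => ?_
    have hv' : ∀ H ∈ A.hyperplanes, H ≠ H₀ → ψ H v = 0 := by
      simpa using hv
    exact (hψmem H₀ hH₀ v).1 (hu v fun H hH hne => (hψmem H hH v).2 (hv' H hH hne))
  -- All forms annihilate `w`, so their rank is at most `|V| - 1`; this leaves room for `H₀`.
  have hcard : B.ncard + 1 ≤ Fintype.card V := by
    have hle : Submodule.span K (ψ '' B) ≤ (Submodule.span K {w}).dualAnnihilator := by
      rw [Submodule.span_le]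
      rintro _ ⟨H, hH, rfl⟩
      rw [SetLike.mem_coe, Submodule.mem_dualAnnihilator]
      intro y hy
      obtain ⟨c, rfl⟩ := Submodule.mem_span_singleton.1 hy
      rw [map_smul, (hψmem H (hBA' hH) w).1 (hwA H (hBA' hH)), smul_zero]
    have h1 := Submodule.finrank_mono hle
    have h2 := Subspace.finrank_add_finrank_dualAnnihilator_eq (Submodule.span K {w})
    rw [finrank_span_singleton hw, Module.finrank_fintype_fun_eq_card] at h2
    have : Fintype B := hBfin.fintype
    have h3 : Module.finrank K (Submodule.span K (ψ '' B)) = B.ncard := by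
      rw [Set.image_eq_range, finrank_span_eq_card hB, ← Nat.card_eq_fintype_card,
        Nat.card_coe_set_eq]
    rw [h3] at h1
    exact (Nat.add_le_add_right h1 1).trans ((add_comm _ _).trans h2).le
  have hdepB : A.IsDependent (insert H₀ B) := by
    refine A.isDependent_of_not_linearIndepOn (φ := ψ) (Set.insert_subset hH₀ hBA')
      (fun H hH => hψ H (Set.insert_subset hH₀ hBA' hH)) fun hind => ?_
    exact (linearIndepOn_insert hH₀B).1 hind |>.2 hmem
  have hfin : {T | T ⊆ insert H₀ B ∧ A.IsDependent T}.Finite :=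
    (hBfin.insert H₀).finite_subsets.subset fun T hT => hT.1
  obtain ⟨T, hTle, hT⟩ := hfin.exists_le_minimal ⟨subset_rfl, hdepB⟩
  -- Minimality among subsets of `insert H₀ B` is absolute, since subsets of `T` stay in that
  -- family.
  have hTmin : A.IsMinimalDependent T :=
    ⟨hT.prop.2, fun U hU hUT => hT.le_of_le ⟨hUT.trans hTle, hU⟩ hUT⟩
  have hTcard : T.ncard ≤ Fintype.card V := by
    have h1 := Set.ncard_le_ncard hTle (hBfin.insert H₀)
    have h2 := Set.ncard_insert_le H₀ B
    omega
  have hTB : T ⊆ B := fun H hH => (hTle hH).resolve_left fun h =>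
    hdep T hTmin hTcard (h ▸ hH)
  exact A.not_isDependent_of_linearIndepOn (fun H hH => hψ H (hBA' (hTB hH))) (hB.mono hTB)
    hTmin.prop

/-! ### Chambers -/

/-- Points of a set joined by a segment in it lie in the same connected component. -/
theorem mk_eq_mk_of_segment_subset {E : Type*} [AddCommGroup E] [Module ℝ E] [TopologicalSpace E]
    [IsTopologicalAddGroup E] [ContinuousSMul ℝ E] {s : Set E} (x y : s)
    (h : segment ℝ (x : E) y ⊆ s) : ConnectedComponents.mk x = ConnectedComponents.mk y := by
  rw [ConnectedComponents.coe_eq_coe']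
  have hpre : IsPreconnected ((↑) ⁻¹' segment ℝ (x : E) y : Set s) := by
    rw [← Topology.IsInducing.subtypeVal.isPreconnected_image, Subtype.image_preimage_coe,
      Set.inter_eq_right.2 h]
    exact (convex_segment _ _).isPreconnected
  exact hpre.subset_connectedComponent (right_mem_segment ℝ _ _) (left_mem_segment ℝ _ _)

/-- Points with the same sign pattern are joined by a segment avoiding every hyperplane, and there
are finitely many patterns. -/
theorem finite_chamber {V : Type*} [Finite V] (A : HyperplaneArrangement ℝ V) :
    Finite A.Chamber := by
  classical
  have : Finite A.hyperplanes := A.finite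
  choose α hα using fun H : A.hyperplanes => A.isHyperplane H H.2
  let sgn : A.complement → A.hyperplanes → Prop := fun x H => 0 < α H x
  have hsgn : ∀ x y : A.complement, sgn x = sgn y →
      ConnectedComponents.mk x = ConnectedComponents.mk y := by
    refine fun x y hxy => mk_eq_mk_of_segment_subset x y fun z hz H hH hzH => ?_
    have hx : α ⟨H, hH⟩ x ≠ 0 := fun h => x.2 H hH (((hα ⟨H, hH⟩).2 x).2 h)
    have hy : α ⟨H, hH⟩ y ≠ 0 := fun h => y.2 H hH (((hα ⟨H, hH⟩).2 y).2 h)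
    have hz0 : α ⟨H, hH⟩ z = 0 := ((hα ⟨H, hH⟩).2 z).1 hzH
    have hiff : 0 < α ⟨H, hH⟩ x ↔ 0 < α ⟨H, hH⟩ y := iff_of_eq (congrFun hxy ⟨H, hH⟩)
    have hz' : α ⟨H, hH⟩ z ∈ segment ℝ (α ⟨H, hH⟩ x) (α ⟨H, hH⟩ y) := by
      rw [← image_segment]
      exact Set.mem_image_of_mem _ hz
    rw [hz0] at hz'
    rcases lt_or_gt_of_ne hx with h | h
    · have hy' : α ⟨H, hH⟩ y < 0 := lt_of_le_of_ne (not_lt.1 fun h' => (hiff.2 h').not_gt h) hy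
      exact lt_irrefl (0 : ℝ) ((convex_Iio (0 : ℝ)).segment_subset h hy' hz')
    · exact lt_irrefl (0 : ℝ) ((convex_Ioi (0 : ℝ)).segment_subset h (hiff.1 h) hz')
  have hsurj : Function.Surjective fun p : Set.range sgn =>
      ConnectedComponents.mk (Classical.choose p.2) := by
    intro c
    obtain ⟨x, rfl⟩ := ConnectedComponents.surjective_coe c
    exact ⟨⟨sgn x, x, rfl⟩, hsgn _ _ (Classical.choose_spec (⟨x, rfl⟩ : sgn x ∈ Set.range sgn))⟩
  exact Finite.of_surjective _ hsurj

namespace IsTransversalExtension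

variable {V : Type*} {A A' : HyperplaneArrangement ℝ V} {f : (V → ℝ) →ₗ[ℝ] ℝ} {u : V → ℝ}

theorem mem_complement_iff (h : IsTransversalExtension A A' f u) (x : V → ℝ) :
    x ∈ A'.complement ↔ f x ≠ 0 ∧ x ∈ A.complement := by
  simp [complement, h.hyperplanes_eq]

theorem add_smul_mem_complement (h : IsTransversalExtension A A' f u) {x : V → ℝ}
    (hx : x ∈ A.complement) (t : ℝ) : x + t • u ∈ A.complement :=
  fun H hH hxH => hx H hH ((h.add_smul_mem_iff hH x t).1 hxH)

/-- Points of the complement that differ by a multiple of `u` lie in the same chamber. -/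
theorem mk_eq_mk_of_eq_add_smul (h : IsTransversalExtension A A' f u) (x y : A.complement)
    (t : ℝ) (hxy : (y : V → ℝ) = x + t • u) :
    ConnectedComponents.mk x = ConnectedComponents.mk y := by
  refine mk_eq_mk_of_segment_subset x y fun z hz => ?_
  rw [segment_eq_image', hxy] at hz
  obtain ⟨θ, -, rfl⟩ := hz
  convert h.add_smul_mem_complement x.2 (θ * t) using 1
  simp [smul_smul]

/-- Points of the complement of the larger arrangement that differ by a multiple of `u` and lie on
the same side of the added hyperplane lie in the same chamber. -/
theorem mk_eq_mk_of_eq_add_smul_of_mul_pos (h : IsTransversalExtension A A' f u)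
    (x y : A'.complement) (t : ℝ) (hxy : (y : V → ℝ) = x + t • u) (hpos : 0 < f x * f y) :
    ConnectedComponents.mk x = ConnectedComponents.mk y := by
  refine mk_eq_mk_of_segment_subset x y fun z hz => ?_
  rw [h.mem_complement_iff]
  constructor
  · intro hz0
    have hz' : f z ∈ segment ℝ (f x) (f y) := by
      have := Set.mem_image_of_mem f.toAffineMap hz
      rwa [image_segment] at this
    rw [hz0] at hz'
    rcases mul_pos_iff.1 hpos with ⟨h1, h2⟩ | ⟨h1, h2⟩
    · exact lt_irrefl (0 : ℝ) ((convex_Ioi (0 : ℝ)).segment_subset h1 h2 hz')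
    · exact lt_irrefl (0 : ℝ) ((convex_Iio (0 : ℝ)).segment_subset h1 h2 hz')
  · rw [segment_eq_image', hxy] at hz
    obtain ⟨θ, -, rfl⟩ := hz
    convert h.add_smul_mem_complement ((h.mem_complement_iff x).1 x.2).2 (θ * t) using 1
    simp [smul_smul]

/-- A point of the complement of `A'`, as a point of the complement of `A` together with the side
of the added hyperplane. -/
noncomputable def toSide (h : IsTransversalExtension A A' f u) (x : A'.complement) :
    A.complement × Bool :=
  (⟨x, ((h.mem_complement_iff x).1 x.2).2⟩, decide (0 < f x))

/-- Translate a point of the complement of `A` along `u` to a given side of the added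
hyperplane. -/
noncomputable def ofSide (h : IsTransversalExtension A A' f u) (b : Bool) (x : A.complement) :
    A'.complement :=
  -- The coefficient makes the new value of `f` equal to `± exp (f x)`, of prescribed sign and never
  -- zero.
  ⟨x + ((if b then 1 else -1) * Real.exp (f x) - f x) • u, by
    rw [h.mem_complement_iff]
    refine ⟨?_, h.add_smul_mem_complement x.2 _⟩
    cases b <;> simp [h.apply_eq_one]⟩

theorem apply_ofSide (h : IsTransversalExtension A A' f u) (b : Bool) (x : A.complement) :
    f (h.ofSide b x) = (if b then 1 else -1) * Real.exp (f x) := by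
  simp [ofSide, h.apply_eq_one]

theorem continuous_toSide [Finite V] (h : IsTransversalExtension A A' f u) :
    Continuous h.toSide := by
  have hf : Continuous f := f.continuous_of_finiteDimensional
  refine Continuous.prodMk (by fun_prop) ?_
  refine continuous_bool_rng true |>.2 ?_
  have h1 : (fun x : A'.complement => decide (0 < f x)) ⁻¹' {true} =
      {x : A'.complement | 0 < f x} := by
    ext x
    simp
  rw [h1]
  constructor
  -- The side is locally constant: `f` has no zero on the complement of `A'`, so `0 < f` is also a
  -- closed condition.
  · have h2 : {x : A'.complement | 0 < f x} =
        {x : A'.complement | 0 ≤ f x} := by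
      ext x
      exact ⟨fun hx => le_of_lt (α := ℝ) hx, fun hx => lt_of_le_of_ne hx ((h.mem_complement_iff x).1 x.2).1.symm⟩
    rw [h2]
    exact isClosed_le continuous_const (by fun_prop)
  · exact isOpen_lt continuous_const (by fun_prop)

theorem continuous_ofSide [Finite V] (h : IsTransversalExtension A A' f u) (b : Bool) :
    Continuous (h.ofSide b) := by
  have hf : Continuous f := f.continuous_of_finiteDimensional
  refine Continuous.subtype_mk ?_ _
  fun_prop

/-- The added hyperplane divides every chamber of `A` into two chambers of `A'`. -/
noncomputable def chamberEquiv [Finite V] (h : IsTransversalExtension A A' f u) :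
    A'.Chamber ≃ A.Chamber × Bool where
  toFun := Continuous.connectedComponentsLift
    ((ConnectedComponents.continuous_coe.prodMap continuous_id).comp h.continuous_toSide)
  invFun p := (h.continuous_ofSide p.2).connectedComponentsMap p.1
  left_inv c := by
    obtain ⟨x, rfl⟩ := ConnectedComponents.surjective_coe c
    rw [Continuous.connectedComponentsLift_apply_coe]
    -- The round trip moves `x` along `u` without changing the sign of `f`.
    refine (h.mk_eq_mk_of_eq_add_smul_of_mul_pos _ _ _ rfl ?_).symm
    rw [apply_ofSide]
    have hx := ((h.mem_complement_iff x).1 x.2).1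
    have he := Real.exp_pos (f x)
    rcases lt_or_gt_of_ne hx with h0 | h0
    · simpa [toSide, h0.not_gt] using mul_neg_of_neg_of_pos h0 he
    · simpa [toSide, h0] using mul_pos h0 he
  right_inv := by
    rintro ⟨c, b⟩
    obtain ⟨x, rfl⟩ := ConnectedComponents.surjective_coe c
    have hside : decide (0 < f (h.ofSide b x)) = b := by
      rw [apply_ofSide]
      cases b <;> simp [Real.exp_pos, (Real.exp_pos _).le]
    exact Prod.ext (h.mk_eq_mk_of_eq_add_smul _ _ _ rfl).symm hside

theorem numChambers_eq [Finite V] (h : IsTransversalExtension A A' f u) :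
    A'.numChambers = 2 * A.numChambers := by
  rw [numChambers, numChambers, Nat.card_congr h.chamberEquiv, Nat.card_prod, mul_comm]
  simp

end IsTransversalExtension

end HyperplaneArrangement

/-! ### Graphic arrangements -/

theorem exists_isTransversalExtension_graphicArrangement {K V : Type*} [Field K] [Fintype V]
    (G : SimpleGraph V) {v w : V} (hne : v ≠ w)
    (hdep : ∀ S, (graphicArrangement K (G ⊔ SimpleGraph.edge v w)).IsMinimalDependent S →
      S.ncard ≤ Fintype.card V → diagonalHyperplane K v w ∉ S)
    (hnmem : diagonalHyperplane K v w ∉ (graphicArrangement K G).hyperplanes) :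
    ∃ u, (graphicArrangement K G).IsTransversalExtension
      (graphicArrangement K (G ⊔ SimpleGraph.edge v w)) (coordinateDifference K v w) u := by
  have hins := hyperplanes_graphicArrangement_sup_edge K G hne
  have hone : (1 : V → K) ≠ 0 := fun h => one_ne_zero (congrFun h v)
  obtain ⟨u, hu, hu0⟩ := HyperplaneArrangement.exists_mem_forall_notMem _
    (hins ▸ Set.mem_insert _ _)
    (by rintro _ ⟨i, j, -, rfl⟩; simp [mem_diagonalHyperplane]) hone
    (by rintro _ ⟨i, j, -, rfl⟩; simp [mem_diagonalHyperplane]) hdep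
  rw [mem_diagonalHyperplane, ← sub_eq_zero] at hu0
  -- Rescaled so that the form `x_v - x_w` takes the value 1.
  refine ⟨(u v - u w)⁻¹ • u, hins, ?_, ?_⟩
  · simp [coordinateDifference, hu0]
  · intro H hH x hx t
    have huH : u ∈ H := hu H (hins ▸ Set.mem_insert_of_mem _ hH)
      fun h => hnmem (h ▸ hH)
    obtain ⟨i, j, -, rfl⟩ := hH
    rw [mem_diagonalHyperplane] at hx huH ⊢
    simp [hx, huH]

/-- A diagonal hyperplane determines its pair: the unit vectors at `i` and `j` lie off it, which
forces `{i, j} = {v, w}`. -/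
theorem diagonalHyperplane_mem_graphicArrangement_iff {K V : Type*} [Field K] [Finite V]
    {G : SimpleGraph V} {v w : V} :
    diagonalHyperplane K v w ∈ (graphicArrangement K G).hyperplanes ↔ G.Adj v w := by
  classical
  refine ⟨?_, fun h => ⟨v, w, h, rfl⟩⟩
  rintro ⟨i, j, hij, heq⟩
  have hi : Pi.single (M := fun _ => K) i 1 ∉ diagonalHyperplane K v w := by
    rw [heq, mem_diagonalHyperplane]
    simp [hij.ne']
  have hj : Pi.single (M := fun _ => K) j 1 ∉ diagonalHyperplane K v w := by
    rw [heq, mem_diagonalHyperplane]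
    simp [hij.ne]
  rw [mem_diagonalHyperplane, Pi.single_apply, Pi.single_apply] at hi hj
  have hij' := hij.ne
  have hij'' := hij.symm
  grind

theorem mainTheorem7 {V : Type*} [Fintype V] (G G' : SimpleGraph V) (v₁ v₂ : V)
    (hne : v₁ ≠ v₂) (hnadj : ¬ G.Adj v₁ v₂) (hG' : G' = G ⊔ SimpleGraph.edge v₁ v₂)
    (hdep : ∀ S : Set (AffineSubspace ℝ (V → ℝ)),
      (graphicArrangement ℝ G').IsMinimalDependent S → S.ncard ≤ Fintype.card V →
        diagonalHyperplane ℝ v₁ v₂ ∉ S) :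
    Polynomial.X * (graphicArrangement ℝ G').charPoly =
        (graphicArrangement ℝ G).charPoly * (Polynomial.X - 1) ∧
      Finite (graphicArrangement ℝ G).Chamber ∧
      Finite (graphicArrangement ℝ G').Chamber ∧
      (graphicArrangement ℝ G').numChambers = 2 * (graphicArrangement ℝ G).numChambers := by
  subst hG'
  obtain ⟨u, h⟩ := exists_isTransversalExtension_graphicArrangement G hne hdep
    (diagonalHyperplane_mem_graphicArrangement_iff.not.2 hnadj)
  exact ⟨h.X_mul_charPoly, HyperplaneArrangement.finite_chamber _,
    HyperplaneArrangement.finite_chamber _, h.numChambers_eq⟩
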